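/- A VASS of dimension $n\ge 1$ is a triple $\mathcal V=(Q,n,\delta)$ with $Q$ a nonempty finite set of control states and $\delta\subseteq Q\times\mathbb Z^n\times Q$ finite. A configuration is an element of $Q\times\mathbb N^n$. We write $(q,\mathbf x)\to(q',\mathbf x')$ if $(q,\mathbf b,q')\in\delta$ for some $\mathbf b$ with $\mathbf x'=\mathbf x+\mathbf b$. A run is a nonempty sequence of configurations in which consecutive ones are related by $\to$. For $X\subseteq\{1,\dots,n\}$, the initialized VASS $(\mathcal V,(q_0,\mathbf x_0))$ is simultaneously $X$-unbounded if for every $B\ge 0$ there is a finite run from $(q_0,\mathbf x_0)$ to some $(q,\mathbf y)$ with $\mathbf y(i)\ge B$ for all $i\in X$. It is $i$-unbounded if it is simultaneously $\{i\}$-unbounded. A disjointness sequence is a nonempty sequence $\sigma=X_1\cdots X_K$ of nonempty, pairwise disjoint subsets of $\{1,\dots,n\}$. A finite run satisfies $\mathrm{PB}_\sigma$ if it can be decomposed as $$(q_0,\mathbf x_0)\xrightarrow{\pi_0'}(q_1,\mathbf x_1)\xrightarrow{\pi_1}(q_2,\mathbf x_2)\xrightarrow{\pi_1'}\cdots\xrightarrow{\pi_{K-1}'}(q_{2K-1},\mathbf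 x_{2K-1})\xrightarrow{\pi_K}(q_{2K},\mathbf x_{2K})$$ such that for every $l\in\{1,\dots,K\}$: - $q_{2l-1}=q_{2l}$; - $\mathbf x_{2l-1}(j)<\mathbf x_{2l}(j)$ for all $j\in X_l$; - for all $j\in\{1,\dots,n\}\setminus X_l$, $\mathbf x_{2l}(j)<\mathbf x_{2l-1}(j)$ implies $j\in\bigcup_{1\le l'<l}X_{l'}$. **Lemma.** Let $(\mathcal V,(q_0,\mathbf x_0))$ be an initialized VASS of dimension $n$ and let $X\subseteq\{1,\dots,n\}$ be nonempty. Then $(\mathcal V,(q_0,\mathbf x_0))$ is simultaneously $X$-unbounded if and only if there is a run starting at $(q_0,\mathbf x_0)$ that satisfies $\mathrm{PB}_\sigma$ for some disjointness sequence $\sigma=X_1\cdots X_K$ with $X\subseteq X_1\cup\cdots\cup X_K$ and $X\cap X_K\ne\emptyset$. Consequently, for every $i\in\{1,\dots,n\}$, $(\mathcal V,(q_0,\mathbf x_0))$ is $i$-unbounded if and only if there is a run starting at $(q_0,\mathbf x_0)$ that satisfies $\mathrm{PB}_\sigma$ for some disjointness sequence $\sigma=X_1\cdots X_K$ with $i\in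 X_K$. -/

import Mathlib

/-- A vector addition system with states, with control states `Q` and dimension `n`, given by its
finite transition relation `δ ⊆ Q × ℤⁿ × Q`. Finiteness of `Q` is a hypothesis where it is used. -/
structure VASS (Q : Type*) (n : ℕ) where
  /-- The transition relation. -/
  trans : Finset (Q × (Fin n → ℤ) × Q)

namespace VASS

/-- Configurations: elements of `Q × ℕⁿ`. -/
abbrev Config (Q : Type*) (n : ℕ) : Type _ := Q × (Fin n → ℕ)

/-- `(q, x) → (q', x')`: there is a transition `(q, b, q')` of the system with `x' = x + b`. -/
def Step {Q : Type*} {n : ℕ} (V : VASS Q n) (c c' : Config Q n) : Prop :=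
  ∃ b : Fin n → ℤ, (c.1, b, c'.1) ∈ V.trans ∧ ∀ i : Fin n, (c'.2 i : ℤ) = (c.2 i : ℤ) + b i

/-- A finite run: a nonempty finite sequence of configurations, each obtained from the preceding
one by a transition; `length` is the number of transitions. -/
structure Run {Q : Type*} {n : ℕ} (V : VASS Q n) where
  /-- The number of transitions. -/
  length : ℕ
  /-- The configurations of the run. -/
  conf : Fin (length + 1) → Config Q n
  step : ∀ i : Fin length, V.Step (conf i.castSucc) (conf i.succ)

/-- The first configuration of a run. -/
def Run.first {Q : Type*} {n : ℕ} {V : VASS Q n} (ρ : V.Run) : Config Q n := ρ.conf 0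

/-- The last configuration of a run. -/
def Run.last {Q : Type*} {n : ℕ} {V : VASS Q n} (ρ : V.Run) : Config Q n :=
  ρ.conf (Fin.last ρ.length)

/-- Simultaneous `X`-unboundedness of the initialized VASS `(V, c₀)`. -/
def SimUnbounded {Q : Type*} {n : ℕ} (V : VASS Q n) (c₀ : Config Q n) (X : Set (Fin n)) : Prop :=
  ∀ B : ℕ, ∃ ρ : V.Run, ρ.first = c₀ ∧ ∀ i ∈ X, B ≤ ρ.last.2 i

/-- `i`-unboundedness (place unboundedness) of the initialized VASS `(V, c₀)`. -/
def PlaceUnbounded {Q : Type*} {n : ℕ} (V : VASS Q n) (c₀ : Config Q n) (i : Fin n) : Prop :=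
  V.SimUnbounded c₀ {i}

/-- A disjointness sequence `X_1 ⋯ X_K`: a nonempty sequence of nonempty, pairwise disjoint sets
of components. The sets are indexed from `0` to `K - 1`. -/
structure DisjointnessSeq (n : ℕ) where
  /-- The length `K` of the sequence. -/
  K : ℕ
  K_pos : 0 < K
  /-- The members of the sequence. -/
  X : Fin K → Set (Fin n)
  nonempty : ∀ l, (X l).Nonempty
  disjoint : ∀ l l', l ≠ l' → X l ∩ X l' = ∅

/-- The last index of a disjointness sequence. -/
def DisjointnessSeq.lastIdx {n : ℕ} (σ : DisjointnessSeq n) : Fin σ.K :=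
  ⟨σ.K - 1, Nat.sub_lt σ.K_pos Nat.one_pos⟩

/-- The run `ρ` satisfies `PB_σ`. The functions `s` and `e` give a decomposition of `ρ`: `s l` and
`e l` are the positions in `ρ` where the segment `π_l` starts and ends, that is, the positions of
the configurations with numbers `2l - 1` and `2l`. All segments may be empty as far as the
decomposition is concerned, and the last segment `π_K` ends where `ρ` ends. -/
def Run.SatisfiesPB {Q : Type*} {n : ℕ} {V : VASS Q n} (ρ : V.Run) (σ : DisjointnessSeq n) :
    Prop :=
  ∃ s e : Fin σ.K → Fin (ρ.length + 1),
    -- `s 1 ≤ e 1 ≤ s 2 ≤ e 2 ≤ ⋯ ≤ s K ≤ e K`, the end of the run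
    (∀ l, s l ≤ e l) ∧ (∀ l l', l < l' → e l ≤ s l') ∧ e σ.lastIdx = Fin.last ρ.length ∧
    -- (P0)
    (∀ l, (ρ.conf (s l)).1 = (ρ.conf (e l)).1) ∧
    -- (STRICT)
    (∀ l, ∀ j ∈ σ.X l, (ρ.conf (s l)).2 j < (ρ.conf (e l)).2 j) ∧
    -- (NONSTRICT)
    (∀ l, ∀ j ∉ σ.X l, (ρ.conf (e l)).2 j < (ρ.conf (s l)).2 j → ∃ l' < l, j ∈ σ.X l')

end VASS

/-! Pumping gives one direction (`Run.SatisfiesPB.exists_large`): a segment can lower only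
components of earlier sets, so it can be repeated at will once the earlier segments have been
repeated often enough to pay for it.

Conversely, an unbounded configuration starts an infinite path of distinct, still unbounded
configurations (a König argument). By Dickson's lemma this path contains a loop with nonnegative,
nonzero effect (`UnboundedOff.exists_loop`). Let `A` be the set of components that the loop
increases. If `A` misses part of `X`, freeze `A` and continue from the end of the loop; induction on
the number of unfrozen components gives the remaining segments. These need only a finite supply in
`A`, which repeating the loop provides (`UnboundedOff.exists_pumpChain`). The recursion stops when
`A` covers what is left of `X`, so the last set meets `X`. -/

namespace VASS

variable {Q : Type*} {n : ℕ}

/-! ### Paths with frozen components. -/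

/-- Steps of `V` in which the components in `Z` are frozen: they keep their values and impose no
constraint. -/
def StepOff (V : VASS Q n) (Z : Set (Fin n)) (c c' : Config Q n) : Prop :=
  ∃ b : Fin n → ℤ, (c.1, b, c'.1) ∈ V.trans ∧ (∀ i ∈ Z, c'.2 i = c.2 i) ∧
    ∀ i ∉ Z, (c'.2 i : ℤ) = (c.2 i : ℤ) + b i

/-- Reachability by steps in which the components in `Z` are frozen. -/
def ReachOff (V : VASS Q n) (Z : Set (Fin n)) : Config Q n → Config Q n → Prop :=
  Relation.ReflTransGen (V.StepOff Z)

theorem stepOff_empty {V : VASS Q n} {c c' : Config Q n} : V.StepOff ∅ c c' ↔ V.Step c c' := by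
  simp [StepOff, Step]

theorem StepOff.add {V : VASS Q n} {Z : Set (Fin n)} {c c' : Config Q n} (h : V.StepOff Z c c')
    (v : Fin n → ℕ) : V.StepOff Z (c.1, c.2 + v) (c'.1, c'.2 + v) := by
  obtain ⟨b, hb, hZ, hb'⟩ := h
  refine ⟨b, hb, fun i hi => by simp [hZ i hi], fun i hi => ?_⟩
  have := hb' i hi
  simp only [Pi.add_apply]
  push_cast
  omega

/-- Monotonicity of reachability: adding the same vector to both ends. -/
theorem ReachOff.add {V : VASS Q n} {Z : Set (Fin n)} {c c' : Config Q n} (h : V.ReachOff Z c c')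
    (v : Fin n → ℕ) : V.ReachOff Z (c.1, c.2 + v) (c'.1, c'.2 + v) :=
  Relation.ReflTransGen.lift (fun d : Config Q n => (d.1, d.2 + v)) (fun _ _ h => h.add v) _ _ h

/-- Reachability from a larger configuration. -/
theorem ReachOff.of_le {V : VASS Q n} {Z : Set (Fin n)} {c c' : Config Q n}
    (h : V.ReachOff Z c c') {y : Fin n → ℕ} (hy : ∀ j, c.2 j ≤ y j) :
    V.ReachOff Z (c.1, y) (c'.1, fun j => c'.2 j + (y j - c.2 j)) := by
  have := h.add (fun j => y j - c.2 j)
  have e : c.2 + (fun j => y j - c.2 j) = y := by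
    funext j
    have := hy j
    simp only [Pi.add_apply]
    omega
  rw [e] at this
  exact this

theorem ReachOff.frozen {V : VASS Q n} {Z : Set (Fin n)} {c c' : Config Q n}
    (h : V.ReachOff Z c c') {i : Fin n} (hi : i ∈ Z) : c'.2 i = c.2 i := by
  induction h with
  | refl => rfl
  | tail _ h ih =>
    obtain ⟨b, -, hZ, -⟩ := h
    rw [hZ i hi, ih]

/-- Freezing more components preserves reachability up to the frozen components. -/
theorem ReachOff.freeze {V : VASS Q n} {Z Z' : Set (Fin n)} (hZ : Z ⊆ Z') {c c' : Config Q n}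
    (h : V.ReachOff Z c c') :
    ∃ y : Fin n → ℕ, V.ReachOff Z' c (c'.1, y) ∧ ∀ i ∉ Z', y i = c'.2 i := by
  classical
  induction h with
  | refl => exact ⟨c.2, Relation.ReflTransGen.refl, fun _ _ => rfl⟩
  | @tail d d' _ h ih =>
    obtain ⟨y, hy, hy'⟩ := ih
    obtain ⟨b, hb, -, hb'⟩ := h
    refine ⟨fun i => if i ∈ Z' then y i else d'.2 i, hy.tail ⟨b, hb, ?_, ?_⟩, ?_⟩
    · intro i hi
      simp [hi]
    · intro i hi
      simp only [hi, if_false]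
      rw [hb' i (fun h => hi (hZ h)), hy' i hi]
    · intro i hi
      simp [hi]

/-- A path on which the components in `Z ∪ A` are frozen can be followed with only those in `Z`
frozen, provided that it is started with large values in `A`. -/
theorem ReachOff.unfreeze {V : VASS Q n} {Z A : Set (Fin n)} {c c' : Config Q n}
    (h : V.ReachOff (Z ∪ A) c c') : ∃ K : ℕ, ∀ (M : ℕ) (y : Fin n → ℕ),
      (∀ i ∉ Z ∪ A, y i = c.2 i) → (∀ i ∈ A, i ∉ Z → M + K ≤ y i) →
      ∃ z : Fin n → ℕ, V.ReachOff Z (c.1, y) (c'.1, z) ∧ (∀ i ∉ Z ∪ A, z i = c'.2 i) ∧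
        ∀ i ∈ A, i ∉ Z → M ≤ z i := by
  classical
  induction h with
  | refl => exact ⟨0, fun M y h1 h2 => ⟨y, Relation.ReflTransGen.refl, h1, h2⟩⟩
  | @tail d d' _ h ih =>
    obtain ⟨K, hK⟩ := ih
    obtain ⟨b, hb, -, hb'⟩ := h
    -- The sum bounds every `|b i|`, so it pays for the last step in each component of `A`.
    refine ⟨K + ∑ j, (b j).natAbs, fun M y h1 h2 => ?_⟩
    obtain ⟨z, hz, hz1, hz2⟩ := hK (M + ∑ j, (b j).natAbs) y h1
      (fun i hi hi' => by have := h2 i hi hi'; omega)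
    have hle : ∀ i, (b i).natAbs ≤ ∑ j, (b j).natAbs := fun i =>
      Finset.single_le_sum (f := fun j => (b j).natAbs) (fun _ _ => Nat.zero_le _)
        (Finset.mem_univ i)
    have hval : ∀ i ∉ Z, (((z i : ℤ) + b i).toNat : ℤ) = (z i : ℤ) + b i := by
      intro i hi
      apply Int.toNat_of_nonneg
      by_cases hA : i ∈ A
      · have := hz2 i hA hi
        have := hle i
        omega
      · have hn : i ∉ Z ∪ A := by simp [hi, hA]
        rw [hz1 i hn, ← hb' i hn]
        positivity
    refine ⟨fun i => if i ∈ Z then z i else ((z i : ℤ) + b i).toNat,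
      hz.tail ⟨b, hb, ?_, ?_⟩, ?_, ?_⟩
    · intro i hi
      simp [hi]
    · intro i hi
      simp only [hi, if_false]
      exact hval i hi
    · intro i hi
      have hZ : i ∉ Z := fun h => hi (Or.inl h)
      simp only [hZ, if_false]
      have h3 := hval i hZ
      rw [hz1 i hi, ← hb' i hi] at h3
      rw [hz1 i hi, ← hb' i hi]
      exact_mod_cast h3
    · intro i hi hi'
      simp only [hi', if_false]
      have := hz2 i hi hi'
      have := hle i
      have := hval i hi'
      omega

/-- Iteration of a loop with effect at least `0`. -/
theorem ReachOff.iterate {V : VASS Q n} {Z : Set (Fin n)} {s e : Config Q n}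
    (h : V.ReachOff Z s e) (hq : s.1 = e.1) (hle : s.2 ≤ e.2) (M : ℕ) :
    V.ReachOff Z s (e.1, s.2 + (M + 1) • (e.2 - s.2)) := by
  have he : s.2 + (e.2 - s.2) = e.2 := add_tsub_cancel_of_le hle
  induction M with
  | zero => simpa [he] using h
  | succ M ih =>
    have h1 := h.add ((M + 1) • (e.2 - s.2))
    rw [hq] at h1
    refine ih.trans ?_
    have e2 : s.2 + (M + 1 + 1) • (e.2 - s.2) = e.2 + (M + 1) • (e.2 - s.2) := by
      rw [succ_nsmul' _ (M + 1), ← add_assoc, he]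
    rw [e2]
    exact h1

/-! ### Loops from unboundedness. -/

/-- `X`-unboundedness by paths on which the components in `Z` are frozen. -/
def UnboundedOff (V : VASS Q n) (Z X : Set (Fin n)) (c : Config Q n) : Prop :=
  ∀ B : ℕ, ∃ y, V.ReachOff Z c y ∧ ∀ i ∈ X, i ∉ Z → B ≤ y.2 i

theorem finite_stepOff (V : VASS Q n) (Z : Set (Fin n)) (c : Config Q n) :
    {c' | V.StepOff Z c c'}.Finite := by
  classical
  refine (V.trans.finite_toSet.image fun t => ((t.2.2, fun i =>
    if i ∈ Z then c.2 i else ((c.2 i : ℤ) + t.2.1 i).toNat) : Config Q n)).subset ?_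
  rintro ⟨q, x⟩ ⟨b, hb, hZ, hb'⟩
  refine ⟨(c.1, b, q), hb, ?_⟩
  simp only [Prod.mk.injEq, true_and]
  funext i
  by_cases hi : i ∈ Z
  · simp [hi, ← hZ i hi]
  · have := hb' i hi
    simp only [hi, if_false]
    simp only at this
    omega

/-- Steps with the components in `Z` frozen whose target is not in `H`. -/
def StepAvoid (V : VASS Q n) (Z : Set (Fin n)) (H : Set (Config Q n)) (c c' : Config Q n) : Prop :=
  V.StepOff Z c c' ∧ c' ∉ H

/-- `X`-unboundedness by paths that avoid `H` and on which the components in `Z` are frozen. -/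
def UnboundedAvoid (V : VASS Q n) (Z X : Set (Fin n)) (H : Set (Config Q n)) (c : Config Q n) :
    Prop :=
  ∀ B : ℕ, ∃ y, Relation.ReflTransGen (V.StepAvoid Z H) c y ∧ ∀ i ∈ X, i ∉ Z → B ≤ y.2 i

theorem UnboundedAvoid.unboundedOff {V : VASS Q n} {Z X : Set (Fin n)} {H : Set (Config Q n)}
    {c : Config Q n} (h : V.UnboundedAvoid Z X H c) : V.UnboundedOff Z X c := fun B => by
  obtain ⟨y, hy, hB⟩ := h B
  exact ⟨y, Relation.ReflTransGen.mono (fun _ _ h => h.1) _ _ hy, hB⟩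

/-- A path that avoids `H` and leads from `c` elsewhere can be cut at its last visit to `c`. -/
theorem reach_stepAvoid_insert {V : VASS Q n} {Z : Set (Fin n)} {H : Set (Config Q n)}
    {c y : Config Q n} (h : Relation.ReflTransGen (V.StepAvoid Z H) c y) :
    y = c ∨ ∃ d, V.StepOff Z c d ∧ d ∉ insert c H ∧
      Relation.ReflTransGen (V.StepAvoid Z (insert c H)) d y := by
  induction h with
  | refl => exact Or.inl rfl
  | @tail y z _ h ih =>
    by_cases hz : z = c
    · exact Or.inl hz
    have hz' : z ∉ insert c H := by
      rintro (h' | h')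
      · exact hz h'
      · exact h.2 h'
    rcases ih with rfl | ⟨d, h1, h2, h3⟩
    · exact Or.inr ⟨z, h.1, hz', Relation.ReflTransGen.refl⟩
    · exact Or.inr ⟨d, h1, h2, h3.tail ⟨h.1, hz'⟩⟩

/-- Inductive step of the König argument: cutting paths at their last visit to `c` allows `c` to be
forbidden from then on. -/
theorem UnboundedAvoid.exists_step {V : VASS Q n} {Z X : Set (Fin n)} {H : Set (Config Q n)}
    {c : Config Q n} (hX : (X \ Z).Nonempty) (h : V.UnboundedAvoid Z X H c) :
    ∃ d, V.StepOff Z c d ∧ d ∉ insert c H ∧ V.UnboundedAvoid Z X (insert c H) d := by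
  obtain ⟨i, hiX, hiZ⟩ := hX
  have key : ∀ B : ℕ, ∃ d : {d // V.StepOff Z c d}, d.1 ∉ insert c H ∧ ∃ y,
      Relation.ReflTransGen (V.StepAvoid Z (insert c H)) d.1 y ∧ ∀ i ∈ X, i ∉ Z → B ≤ y.2 i := by
    intro B
    -- A bound above `c.2 i` rules out `y = c`.
    obtain ⟨y, hy, hB⟩ := h (B + c.2 i + 1)
    rcases reach_stepAvoid_insert hy with rfl | ⟨d, h1, h2, h3⟩
    · have := hB i hiX hiZ
      omega
    · exact ⟨⟨d, h1⟩, h2, y, h3, fun j hj hj' => by have := hB j hj hj'; omega⟩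
  choose f hf hf' using key
  have : Finite {d // V.StepOff Z c d} := V.finite_stepOff Z c
  -- Some successor serves infinitely many bounds, hence arbitrarily large ones.
  obtain ⟨d, hd⟩ := Finite.exists_infinite_fiber f
  have hd' : (f ⁻¹' {d}).Infinite := Set.infinite_coe_iff.mp hd
  refine ⟨d.1, d.2, ?_, fun B => ?_⟩
  · obtain ⟨B, hB⟩ := hd'.nonempty
    have := hf B
    rwa [show f B = d from hB] at this
  · obtain ⟨B', hB', hlt⟩ := hd'.exists_gt B
    obtain ⟨y, hy, hy'⟩ := hf' B'
    rw [show f B' = d from hB'] at hy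
    exact ⟨y, hy, fun j hj hj' => hlt.le.trans (hy' j hj hj')⟩

/-- The state of the recursion carries the set of configurations already visited, which makes the
path injective. -/
theorem UnboundedOff.exists_seq {V : VASS Q n} {Z X : Set (Fin n)} {c : Config Q n}
    (hX : (X \ Z).Nonempty) (h : V.UnboundedOff Z X c) :
    ∃ d : ℕ → Config Q n, d 0 = c ∧ (∀ k, V.StepOff Z (d k) (d (k + 1))) ∧
      (∀ i j, i < j → d i ≠ d j) ∧ ∀ k, V.UnboundedOff Z X (d k) := by
  let S := {p : Set (Config Q n) × Config Q n // p.2 ∉ p.1 ∧ V.UnboundedAvoid Z X p.1 p.2}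
  have hstep : ∀ p : S, ∃ p' : S, V.StepOff Z p.1.2 p'.1.2 ∧ p'.1.1 = insert p.1.2 p.1.1 := by
    rintro ⟨⟨H, d⟩, h1, h2⟩
    obtain ⟨d', h3, h4, h5⟩ := h2.exists_step hX
    exact ⟨⟨(insert d H, d'), h4, h5⟩, h3, rfl⟩
  choose next hn1 hn2 using hstep
  let p₀ : S := ⟨(∅, c), by simp, fun B => by
    obtain ⟨y, hy, hB⟩ := h B
    exact ⟨y, Relation.ReflTransGen.mono (fun _ _ h => ⟨h, by simp⟩) _ _ hy, hB⟩⟩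
  let g : ℕ → S := fun k => Nat.rec p₀ (fun _ p => next p) k
  have hmem : ∀ i j, i < j → (g i).1.2 ∈ (g j).1.1 := by
    intro i j hij
    induction j, hij using Nat.le_induction with
    | base =>
      change _ ∈ (next (g i)).1.1
      rw [hn2]
      exact Set.mem_insert _ _
    | succ j _ ih =>
      change _ ∈ (next (g j)).1.1
      rw [hn2]
      exact Set.mem_insert_of_mem _ ih
  exact ⟨fun k => (g k).1.2, rfl, fun k => hn1 (g k),
    fun i j hij (he : (g i).1.2 = (g j).1.2) => (g j).2.1 (by simpa only [he] using hmem i j hij),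
    fun k => (g k).2.2.unboundedOff⟩

/-- An unbounded configuration reaches a loop with nonnegative, nonzero effect after which it is
still unbounded. -/
theorem UnboundedOff.exists_loop [Finite Q] {V : VASS Q n} {Z X : Set (Fin n)} {c : Config Q n}
    (hX : (X \ Z).Nonempty) (h : V.UnboundedOff Z X c) :
    ∃ s e, V.ReachOff Z c s ∧ V.ReachOff Z s e ∧ s.1 = e.1 ∧ s.2 ≤ e.2 ∧ s.2 ≠ e.2 ∧
      V.UnboundedOff Z X e := by
  obtain ⟨d, rfl, hd, hne, hu⟩ := h.exists_seq hX
  have hreach : ∀ i j, i ≤ j → V.ReachOff Z (d i) (d j) := by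
    intro i j hij
    induction j, hij using Nat.le_induction with
    | base => exact Relation.ReflTransGen.refl
    | succ j _ ih => exact ih.tail (hd j)
  -- Dickson's lemma, with equality on the finite set of control states; distinctness then makes the
  -- effect nonzero.
  have hwqo : WellQuasiOrdered fun a b : Config Q n => a.1 = b.1 ∧ a.2 ≤ b.2 :=
    (Finite.wellQuasiOrdered (fun a b : Q => a = b)).prod (wellQuasiOrdered_le (α := Fin n → ℕ))
  obtain ⟨i, j, hij, hq, hle⟩ := hwqo d
  exact ⟨d i, d j, hreach _ _ (Nat.zero_le _), hreach _ _ hij.le, hq, hle,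
    fun he => hne i j hij (Prod.ext hq he), hu j⟩

/-! ### Chains of pumpable segments. -/

/-- `V.PumpChain Z U c L`: from `c`, with the components in `Z` frozen, there is a chain of
segments that strictly increase the successive members of `L`; a segment may decrease only
components that are in `U` or in an earlier member of `L`. -/
inductive PumpChain (V : VASS Q n) (Z : Set (Fin n)) :
    Set (Fin n) → Config Q n → List (Set (Fin n)) → Prop
  | nil (U : Set (Fin n)) (c : Config Q n) : PumpChain V Z U c []
  | cons {U A : Set (Fin n)} {c s e : Config Q n} {L : List (Set (Fin n))}
      (hcs : V.ReachOff Z c s) (hse : V.ReachOff Z s e) (hq : s.1 = e.1)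
      (hA : A.Nonempty) (hAU : Disjoint A U)
      (hlt : ∀ j ∈ A, s.2 j < e.2 j) (hle : ∀ j ∉ A, e.2 j < s.2 j → j ∈ U)
      (hL : PumpChain V Z (U ∪ A) e L) : PumpChain V Z U c (A :: L)

/-- Unfrozen components lie in `U`, where decreases are allowed and no strict increase is required;
only their supply matters, and `K` adds up the needs of all the paths. -/
theorem PumpChain.unfreeze {V : VASS Q n} {Z A U : Set (Fin n)} {c : Config Q n}
    {L : List (Set (Fin n))} (h : V.PumpChain (Z ∪ A) U c L) (hU : Z ∪ A ⊆ U) :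
    ∃ K : ℕ, ∀ y : Fin n → ℕ, (∀ i ∉ Z ∪ A, y i = c.2 i) → (∀ i ∈ A, i ∉ Z → K ≤ y i) →
      V.PumpChain Z U (c.1, y) L := by
  induction h with
  | nil U c => exact ⟨0, fun y _ _ => .nil _ _⟩
  | @cons U A' c s e L hcs hse hq hA hAU hlt hle _ ih =>
    obtain ⟨K₁, h₁⟩ := hcs.unfreeze
    obtain ⟨K₂, h₂⟩ := hse.unfreeze
    obtain ⟨K₃, h₃⟩ := ih (hU.trans Set.subset_union_left)
    refine ⟨K₃ + K₂ + K₁, fun y hy hyK => ?_⟩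
    obtain ⟨s', hs, hs1, hs2⟩ := h₁ (K₃ + K₂) y hy hyK
    obtain ⟨e', he, he1, he2⟩ := h₂ K₃ s' hs1 hs2
    refine .cons hs he hq hA hAU (fun j hj => ?_) (fun j hj hj' => ?_) (h₃ e' he1 he2)
    · have hj' : j ∉ Z ∪ A := fun h => Set.disjoint_left.mp hAU hj (hU h)
      simpa only [hs1 j hj', he1 j hj'] using hlt j hj
    · by_cases hjZ : j ∈ Z ∪ A
      · exact hU hjZ
      · exact hle j hj (by simpa only [hs1 j hjZ, he1 j hjZ] using hj')

/-- Unboundedness yields a chain of pumpable segments. -/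
theorem UnboundedOff.exists_pumpChain [Finite Q] {V : VASS Q n} {X : Set (Fin n)}
    {Z : Set (Fin n)} {c : Config Q n} (hX : (X \ Z).Nonempty) (h : V.UnboundedOff Z X c) :
    ∃ (L : List (Set (Fin n))) (hL : L ≠ []), V.PumpChain Z Z c L ∧
      (∀ i ∈ X, i ∉ Z → ∃ A ∈ L, i ∈ A) ∧ (X ∩ L.getLast hL).Nonempty := by
  -- Each loop freezes at least one new component.
  induction hm : (Zᶜ).ncard using Nat.strong_induction_on generalizing Z c with
  | _ m ih =>
  obtain ⟨s, e, hcs, hse, hq, hle, hne, hu⟩ := h.exists_loop hX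
  let A : Set (Fin n) := {j | s.2 j < e.2 j}
  have hA : A.Nonempty := by
    obtain ⟨j, hj⟩ := Function.ne_iff.mp hne
    exact ⟨j, lt_of_le_of_ne (hle j) hj⟩
  have hAZ : Disjoint A Z := Set.disjoint_left.mpr fun j hj hjZ => by
    have : s.2 j < e.2 j := hj
    rw [hse.frozen hjZ] at this
    exact lt_irrefl _ this
  by_cases hX' : (X \ (Z ∪ A)).Nonempty
  · have hu' : V.UnboundedOff (Z ∪ A) X e := by
      intro B
      obtain ⟨y, hy, hB⟩ := hu B
      obtain ⟨z, hz, hzy⟩ := hy.freeze (Set.subset_union_left (t := A))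
      refine ⟨_, hz, fun i hi hi' => ?_⟩
      simp only [hzy i hi']
      exact hB i hi fun h => hi' (Or.inl h)
    have hlt : ((Z ∪ A)ᶜ).ncard < m := by
      rw [← hm]
      refine Set.ncard_lt_ncard ⟨Set.compl_subset_compl.mpr Set.subset_union_left, fun hs => ?_⟩
      obtain ⟨j, hj⟩ := hA
      exact hs (fun hjZ => Set.disjoint_left.mp hAZ hj hjZ) (Or.inr hj)
    obtain ⟨L, hL, hp, hcov, hlast⟩ := ih _ hlt hX' hu' rfl
    -- `K + 1` turns raise each component of `A` by at least `K + 1` and, outside `A`, change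
    -- nothing.
    obtain ⟨K, hK⟩ := hp.unfreeze subset_rfl
    have hit := hse.iterate hq hle K
    refine ⟨A :: L, by simp, .cons hcs hit hq hA hAZ ?_ ?_ (hK _ ?_ ?_), ?_, ?_⟩
    · intro j hj
      have hj' : s.2 j < e.2 j := hj
      simp only [Pi.add_apply, Pi.smul_apply, Pi.sub_apply, smul_eq_mul]
      have : 0 < (K + 1) * (e.2 j - s.2 j) := Nat.mul_pos (by omega) (by omega)
      omega
    · exact fun j _ hj' => absurd hj' (not_lt.mpr (Nat.le_add_right _ _))
    · intro j hj
      have h1 : ¬ s.2 j < e.2 j := fun h => hj (Or.inr h)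
      have h2 : s.2 j ≤ e.2 j := hle j
      have h3 : e.2 j - s.2 j = 0 := by omega
      simp only [Pi.add_apply, Pi.smul_apply, Pi.sub_apply, smul_eq_mul, h3]
      omega
    · intro j hj _
      have hj' : s.2 j < e.2 j := hj
      simp only [Pi.add_apply, Pi.smul_apply, Pi.sub_apply, smul_eq_mul]
      have : (K + 1) * 1 ≤ (K + 1) * (e.2 j - s.2 j) := Nat.mul_le_mul_left _ (by omega)
      omega
    · intro i hi hi'
      by_cases hiA : i ∈ A
      · exact ⟨A, by simp, hiA⟩
      · obtain ⟨A', hA', hiA'⟩ := hcov i hi (by simp [hi', hiA])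
        exact ⟨A', by simp [hA'], hiA'⟩
    · rwa [List.getLast_cons hL]
  · have hXA : ∀ i ∈ X, i ∉ Z → i ∈ A := fun i hi hi' => by
      by_contra hiA
      exact hX' ⟨i, hi, by simp [hi', hiA]⟩
    refine ⟨[A], by simp, .cons hcs hse hq hA hAZ (fun j hj => hj) (fun j _ hj => ?_) (.nil _ _),
      fun i hi hi' => ⟨A, by simp, hXA i hi hi'⟩, ?_⟩
    · exact absurd (hle j) (not_le.mpr hj)
    · obtain ⟨i, hi, hi'⟩ := hX
      exact ⟨i, hi, hXA i hi hi'⟩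

/-! ### From chains to runs. -/

/-- A path can be put before a sequence of steps. -/
theorem ReachOff.prepend {V : VASS Q n} {a b : Config Q n} (h : V.ReachOff ∅ a b) {N : ℕ}
    {f : ℕ → Config Q n} (h0 : f 0 = b) (hf : ∀ i < N, V.Step (f i) (f (i + 1))) :
    ∃ (m : ℕ) (g : ℕ → Config Q n), g 0 = a ∧ (∀ i, g (i + m) = f i) ∧
      ∀ i < N + m, V.Step (g i) (g (i + 1)) := by
  induction h using Relation.ReflTransGen.head_induction_on with
  | refl => exact ⟨0, f, h0, fun _ => rfl, hf⟩
  | @head a a' hstep _ ih =>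
    obtain ⟨m, g, hg0, hg, hg'⟩ := ih
    refine ⟨m + 1, fun i => Nat.casesOn i a g, rfl, fun i => hg i, fun i hi => ?_⟩
    cases i with
    | zero =>
      change V.Step a (g 0)
      rw [hg0]
      exact stepOff_empty.mp hstep
    | succ i => exact hg' i (by omega)

/-- The run given by the first `N` steps of a sequence. -/
def Run.ofSeq {V : VASS Q n} (N : ℕ) (f : ℕ → Config Q n)
    (hf : ∀ i < N, V.Step (f i) (f (i + 1))) : V.Run where
  length := N
  conf i := f i
  step i := hf i i.2

theorem ReachOff.exists_run {V : VASS Q n} {a b : Config Q n} (h : V.ReachOff ∅ a b) :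
    ∃ ρ : V.Run, ρ.first = a ∧ ρ.last = b := by
  obtain ⟨m, g, hg0, hg, hg'⟩ := h.prepend (N := 0) (f := fun _ => b) rfl (by simp)
  refine ⟨Run.ofSeq (0 + m) g hg', hg0, hg 0⟩

theorem Run.reachOff {V : VASS Q n} (ρ : V.Run) {i j : Fin (ρ.length + 1)} (hij : i ≤ j) :
    V.ReachOff ∅ (ρ.conf i) (ρ.conf j) := by
  obtain ⟨i, hi⟩ := i
  obtain ⟨j, hj⟩ := j
  have hij : i ≤ j := hij
  induction j, hij using Nat.le_induction with
  | base => exact Relation.ReflTransGen.refl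
  | succ j _ ih =>
    exact (ih (by omega) (by assumption)).tail (stepOff_empty.mpr (ρ.step ⟨j, by omega⟩))

/-- A chain of pumpable segments, laid out along a single sequence of steps. -/
theorem PumpChain.exists_seq {V : VASS Q n} {U : Set (Fin n)} {c : Config Q n}
    {L : List (Set (Fin n))} (h : V.PumpChain ∅ U c L) :
    ∃ (N : ℕ) (f : ℕ → Config Q n) (s e : Fin L.length → ℕ), f 0 = c ∧
      (∀ i < N, V.Step (f i) (f (i + 1))) ∧ (∀ l, s l ≤ e l) ∧ (∀ l l', l < l' → e l ≤ s l') ∧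
      (∀ l, e l ≤ N) ∧ (L.length = 0 → N = 0) ∧ (∀ l, l.val + 1 = L.length → e l = N) ∧
      (∀ l, (f (s l)).1 = (f (e l)).1) ∧ (∀ l, ∀ j ∈ L.get l, (f (s l)).2 j < (f (e l)).2 j) ∧
      (∀ l, ∀ j ∉ L.get l, (f (e l)).2 j < (f (s l)).2 j → j ∈ U ∨ ∃ l' < l, j ∈ L.get l') ∧
      (∀ l, (L.get l).Nonempty) ∧ (∀ l, Disjoint (L.get l) U) ∧
      (∀ l l', l < l' → Disjoint (L.get l) (L.get l')) := by
  induction h with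
  | nil U c =>
    exact ⟨0, fun _ => c, Fin.elim0, Fin.elim0, rfl, by simp, fun l => l.elim0, fun l => l.elim0,
      fun l => l.elim0, fun _ => rfl, fun l => l.elim0, fun l => l.elim0, fun l => l.elim0,
      fun l => l.elim0, fun l => l.elim0, fun l => l.elim0, fun l => l.elim0⟩
  | @cons U A c a b L hca hab hq hA hAU hlt hle _ ih =>
    obtain ⟨N, f, s, e, h0, hstep, hse, hes, heN, hN, hlast, hp0, hst, hns, hne, hdU, hd⟩ := ih
    obtain ⟨m, g, hg0, hg, hg'⟩ := hab.prepend h0 hstep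
    obtain ⟨k, f', hf0, hf, hf'⟩ := hca.prepend hg0 hg'
    have hfa : f' k = a := by rw [← hg0, ← hf, Nat.zero_add]
    have hfs : ∀ i, f' (i + m + k) = f i := fun i => by rw [hf, hg]
    have hfb : f' (m + k) = b := by rw [← h0, ← hfs, Nat.zero_add]
    refine ⟨N + m + k, f', Fin.cons k fun l => s l + m + k,
      Fin.cons (m + k) fun l => e l + m + k, hf0, hf', ?_, ?_, ?_, ?_, ?_, ?_, ?_, ?_, ?_, ?_, ?_⟩
    · refine Fin.cases ?_ fun l => ?_
      · simp
      · have := hse l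
        simp only [Fin.cons_succ]
        omega
    · refine Fin.cases (fun l' => ?_) fun l l' => ?_
      · refine Fin.cases ?_ (fun l' => ?_) l'
        · intro h
          exact absurd h (lt_irrefl _)
        · intro _
          simp only [Fin.cons_succ, Fin.cons_zero]
          omega
      · refine Fin.cases ?_ (fun l' => ?_) l'
        · intro h
          exact absurd h (Fin.not_lt_zero _)
        · intro h
          have := hes l l' (Fin.succ_lt_succ_iff.mp h)
          simp only [Fin.cons_succ]
          omega
    · refine Fin.cases ?_ fun l => ?_
      · simp only [Fin.cons_zero]
        omega
      · have := heN l
        simp only [Fin.cons_succ]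
        omega
    · simp
    · refine Fin.cases (fun h => ?_) fun l h => ?_
      · simp only [Fin.cons_zero]
        -- If the first segment is also the last, nothing follows it, so it ends the run.
        have := hN (by simpa using h.symm)
        omega
      · have := hlast l (by simpa using h)
        simp only [Fin.cons_succ]
        omega
    · refine Fin.cases ?_ fun l => ?_
      · simpa only [Fin.cons_zero, hfa, hfb] using hq
      · simpa only [Fin.cons_succ, hfs] using hp0 l
    · refine Fin.cases ?_ fun l => ?_
      · simp only [Fin.cons_zero, hfa, hfb]
        exact hlt
      · simp only [Fin.cons_succ, hfs]
        exact hst l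
    · refine Fin.cases (fun j hj h => ?_) fun l j hj h => ?_
      · simp only [Fin.cons_zero, hfa, hfb] at h
        exact Or.inl (hle j hj h)
      · simp only [Fin.cons_succ, hfs] at h
        rcases hns l j hj h with (h | h) | ⟨l', hl', h⟩
        · exact Or.inl h
        · exact Or.inr ⟨0, Fin.succ_pos l, h⟩
        · exact Or.inr ⟨l'.succ, Fin.succ_lt_succ_iff.mpr hl', h⟩
    · exact Fin.cases hA hne
    · exact Fin.cases hAU fun l => (hdU l).mono_right Set.subset_union_left
    · refine Fin.cases (fun l' => ?_) fun l l' => ?_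
      · refine Fin.cases ?_ (fun l' _ => ?_) l'
        · intro h
          exact absurd h (lt_irrefl _)
        · exact ((hdU l').mono_right Set.subset_union_right).symm
      · refine Fin.cases ?_ (fun l' h => ?_) l'
        · intro h
          exact absurd h (Fin.not_lt_zero _)
        · exact hd l l' (Fin.succ_lt_succ_iff.mp h)

theorem PumpChain.exists_run {V : VASS Q n} {c : Config Q n} {L : List (Set (Fin n))}
    (h : V.PumpChain ∅ ∅ c L) (hL : L ≠ []) :
    ∃ (ρ : V.Run) (σ : DisjointnessSeq n), ρ.first = c ∧ ρ.SatisfiesPB σ ∧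
      (⋃ l, σ.X l) = {i | ∃ A ∈ L, i ∈ A} ∧ σ.X σ.lastIdx = L.getLast hL := by
  obtain ⟨N, f, s, e, h0, hstep, hse, hes, heN, hN, hlast, hp0, hst, hns, hne, -, hd⟩ :=
    h.exists_seq
  have hpos : 0 < L.length := List.length_pos_iff.mpr hL
  refine ⟨Run.ofSeq N f hstep, ⟨L.length, hpos, L.get, hne, fun l l' hll => ?_⟩, h0,
    ⟨fun l => ⟨s l, Nat.lt_succ_of_le ((hse l).trans (heN l))⟩,
      fun l => ⟨e l, Nat.lt_succ_of_le (heN l)⟩, hse, hes, ?_, hp0, hst, ?_⟩, ?_, ?_⟩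
  · rw [← Set.disjoint_iff_inter_eq_empty]
    rcases lt_or_gt_of_ne hll with h | h
    · exact hd _ _ h
    · exact (hd _ _ h).symm
  · exact Fin.ext (hlast _ (Nat.sub_add_cancel hpos))
  · intro l j hj hlt
    rcases hns l j hj hlt with h | h
    · exact absurd h (Set.notMem_empty _)
    · exact h
  · ext i
    simp only [Set.mem_iUnion, Set.mem_ofPred_eq]
    constructor
    · rintro ⟨l, hl⟩
      exact ⟨_, List.get_mem L l, hl⟩
    · rintro ⟨A, hA, hi⟩
      obtain ⟨l, rfl⟩ := List.get_of_mem hA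
      exact ⟨l, hi⟩
  · simp only [DisjointnessSeq.lastIdx, List.get_eq_getElem]
    exact (List.getLast_eq_getElem hL).symm

/-! ### Pumping a run. -/

/-- Iteration of a loop that may decrease the components in `P`. -/
theorem ReachOff.iterate_of_le {V : VASS Q n} {Z : Set (Fin n)} {s e : Config Q n}
    (h : V.ReachOff Z s e) (hq : s.1 = e.1) {A P : Set (Fin n)} {D : ℕ}
    (hA : ∀ j ∈ A, s.2 j < e.2 j) (hP : ∀ j ∉ P, s.2 j ≤ e.2 j) (hD : ∀ j, s.2 j ≤ D) (M : ℕ)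
    (y : Fin n → ℕ) (hy : ∀ j, s.2 j ≤ y j) (hyP : ∀ j ∈ P, (M + 1) * D ≤ y j) :
    ∃ z : Fin n → ℕ, V.ReachOff Z (s.1, y) (s.1, z) ∧ (∀ j, s.2 j ≤ z j) ∧
      (∀ j ∈ A, M ≤ z j) ∧ ∀ j ∈ P, y j ≤ z j + M * D := by
  -- A turn costs at most `s.2 j ≤ D` in component `j`, so after `M` turns a stock of `(M + 1) * D`
  -- still leaves `D ≥ s.2 j`.
  induction M with
  | zero => exact ⟨y, Relation.ReflTransGen.refl, hy, by simp, by simp⟩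
  | succ M ih =>
    have hmul : (M + 1 + 1) * D = M * D + D + D := by ring
    have hmul' : (M + 1) * D = M * D + D := by ring
    obtain ⟨z, hz, hsz, hzA, hzP⟩ := ih fun j hj => by
      have := hyP j hj
      omega
    have hr := h.of_le hsz
    rw [← hq] at hr
    refine ⟨_, hz.trans hr, fun j => ?_, fun j hj => ?_, fun j hj => ?_⟩
    · by_cases hj : j ∈ P
      · have h1 := hyP j hj
        have h2 := hzP j hj
        have h3 := hD j
        omega
      · have := hP j hj
        omega
    · have := hA j hj
      have := hzA j hj
      have := hsz j
      omega
    · have h2 := hzP j hj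
      have h3 := hD j
      have := hsz j
      omega

/-- A run that satisfies `PB_σ` can be pumped. -/
theorem Run.SatisfiesPB.exists_large {V : VASS Q n} {ρ : V.Run} {σ : DisjointnessSeq n}
    (h : ρ.SatisfiesPB σ) (B : ℕ) :
    ∃ y, V.ReachOff ∅ ρ.first y ∧ ∀ i ∈ ⋃ l, σ.X l, B ≤ y.2 i := by
  obtain ⟨s, e, hse, hes, -, hq, hst, hns⟩ := h
  -- Dominating the original configuration at `p` lets the run be replayed from there; `B` is
  -- quantified inside because later segments consume earlier supplies.
  have key : ∀ k ≤ σ.K, ∀ p : Fin (ρ.length + 1), (∀ l, l.val < k → e l ≤ p) → ∀ B : ℕ,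
      ∃ y : Fin n → ℕ, V.ReachOff ∅ ρ.first ((ρ.conf p).1, y) ∧ (∀ j, (ρ.conf p).2 j ≤ y j) ∧
        ∀ l, l.val < k → ∀ j ∈ σ.X l, B ≤ y j := by
    intro k
    induction k with
    | zero =>
      intro _ p _ B
      exact ⟨_, ρ.reachOff (Fin.zero_le p), fun j => le_rfl, by simp⟩
    | succ k ih =>
      intro hk p hp B
      let l₀ : Fin σ.K := ⟨k, hk⟩
      let sc := ρ.conf (s l₀)
      let ec := ρ.conf (e l₀)
      let D := ∑ j, (sc.2 j + ec.2 j)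
      have hsum : ∀ j, sc.2 j + ec.2 j ≤ D := fun j =>
        Finset.single_le_sum (f := fun j => sc.2 j + ec.2 j) (fun _ _ => Nat.zero_le _)
          (Finset.mem_univ j)
      -- `(B + D + 1) * D` pays for `B + D` turns of the loop; of the remaining `B + D`, replaying
      -- up to `p` loses at most `D`.
      obtain ⟨y, hy, hsy, hyB⟩ := ih (by omega) (s l₀) (fun l hl => hes l l₀ hl)
        (B + D + (B + D + 1) * D)
      have hloop : V.ReachOff ∅ sc ec := ρ.reachOff (hse l₀)
      obtain ⟨z, hz, hsz, hzA, hzP⟩ := hloop.iterate_of_le (hq l₀) (A := σ.X l₀)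
        (P := {j | ∃ l' < l₀, j ∈ σ.X l'}) (D := D) (hst l₀)
        (fun j hj => by
          by_contra hlt
          by_cases hjA : j ∈ σ.X l₀
          · exact hlt (hst l₀ j hjA).le
          · exact hj (hns l₀ j hjA (not_le.mp hlt)))
        (fun j => by have := hsum j; omega) (B + D) y hsy
        (fun j ⟨l', hl', hj⟩ => by have := hyB l' hl' j hj; omega)
      have hr := ReachOff.of_le (hloop.trans (ρ.reachOff (hp l₀ (Nat.lt_succ_self k)))) hsz
      refine ⟨_, (hy.trans hz).trans hr, fun j => Nat.le_add_right _ _, fun l hl j hj => ?_⟩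
      have hjs := hsum j
      have hmul : (B + D + 1) * D = (B + D) * D + D := by ring
      have hlarge : B + D ≤ z j := by
        rcases Nat.lt_succ_iff_lt_or_eq.mp hl with hl | hl
        · have h1 := hyB l hl j hj
          have h2 := hzP j ⟨l, hl, hj⟩
          omega
        · obtain rfl : l = l₀ := Fin.ext hl
          exact hzA j hj
      omega
  obtain ⟨y, hy, -, hB⟩ := key σ.K le_rfl (Fin.last _) (fun l _ => Fin.le_last _) B
  refine ⟨_, hy, fun i hi => ?_⟩
  obtain ⟨l, hl⟩ := Set.mem_iUnion.mp hi
  exact hB l l.2 i hl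

/-! ### The equivalences. -/

theorem simUnbounded_iff_exists_satisfiesPB [Finite Q] (V : VASS Q n) (c₀ : Config Q n)
    {X : Set (Fin n)} (hX : X.Nonempty) :
    V.SimUnbounded c₀ X ↔
      ∃ ρ : V.Run, ρ.first = c₀ ∧ ∃ σ : DisjointnessSeq n,
        ρ.SatisfiesPB σ ∧ X ⊆ (⋃ l, σ.X l) ∧ (X ∩ σ.X σ.lastIdx).Nonempty := by
  constructor
  · intro h
    have hu : V.UnboundedOff ∅ X c₀ := fun B => by
      obtain ⟨ρ, rfl, hB⟩ := h B
      exact ⟨ρ.last, ρ.reachOff (Fin.zero_le _), fun i hi _ => hB i hi⟩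
    obtain ⟨L, hL, hp, hcov, hlast⟩ := hu.exists_pumpChain (by simpa using hX)
    obtain ⟨ρ, σ, h1, h2, h3, h4⟩ := hp.exists_run hL
    refine ⟨ρ, h1, σ, h2, ?_, h4 ▸ hlast⟩
    rw [h3]
    exact fun i hi => hcov i hi (Set.notMem_empty i)
  · rintro ⟨ρ, rfl, σ, hσ, hsub, -⟩ B
    obtain ⟨y, hy, hB⟩ := hσ.exists_large B
    obtain ⟨ρ', h1, rfl⟩ := hy.exists_run
    exact ⟨ρ', h1, fun i hi => hB i (hsub hi)⟩

end VASS

theorem mainTheorem6 {Q : Type*} [Finite Q] {n : ℕ} (V : VASS Q n) (c₀ : VASS.Config Q n) :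
    (∀ X : Set (Fin n), X.Nonempty →
      (V.SimUnbounded c₀ X ↔
        ∃ ρ : V.Run, ρ.first = c₀ ∧ ∃ σ : VASS.DisjointnessSeq n,
          ρ.SatisfiesPB σ ∧ X ⊆ (⋃ l, σ.X l) ∧ (X ∩ σ.X σ.lastIdx).Nonempty)) ∧
    (∀ i : Fin n,
      (V.PlaceUnbounded c₀ i ↔
        ∃ ρ : V.Run, ρ.first = c₀ ∧ ∃ σ : VASS.DisjointnessSeq n,
          ρ.SatisfiesPB σ ∧ i ∈ σ.X σ.lastIdx)) := by
  refine ⟨fun X hX => VASS.simUnbounded_iff_exists_satisfiesPB V c₀ hX, fun i => ?_⟩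
  rw [VASS.PlaceUnbounded,
    VASS.simUnbounded_iff_exists_satisfiesPB V c₀ (Set.singleton_nonempty i)]
  -- For a singleton, meeting the last set already implies being covered.
  simp only [Set.singleton_subset_iff, Set.singleton_inter_nonempty]
  constructor
  · rintro ⟨ρ, h, σ, h1, -, h2⟩
    exact ⟨ρ, h, σ, h1, h2⟩
  · rintro ⟨ρ, h, σ, h1, h2⟩
    exact ⟨ρ, h, σ, h1, Set.mem_iUnion.mpr ⟨_, h2⟩, h2⟩
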